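/- For an integer $m\ge 0$ let $\mathcal{P}_m$ be the $(m+1)$-dimensional space of complex polynomials in $z$ of degree at most $m$, and let $\mathcal{G}_k\mathcal{P}_m$ be the set of its $k$-dimensional linear subspaces. Let $n\ge 0$ and $k,\ell\ge 0$ be integers with $k+\ell=n+1$. Let $\gamma:\mathcal{P}_n\times\mathcal{P}_n\to\mathbb{C}$ be the bilinear form determined by $$n!\,\gamma\!\left(\frac{z^i}{i!},\frac{z^j}{j!}\right)=\begin{cases}(-1)^i & \text{if } i+j=n,\\ 0 & \text{otherwise,}\end{cases}\qquad 0\le i,j\le n .$$ For $U\in\mathcal{G}_k\mathcal{P}_n$, the apolar dual of $U$ is $$U^*=\{u\in\mathcal{P}_n : \gamma(u,v)=0 \text{ for all } v\in U\}.$$ The Wronskian covariant of a subspace $U\subseteq\mathcal{P}_n$ of dimension $k$ is $W(U)=\operatorname{span}_{\mathbb{C}}\{W(p_1,\dots,p_k)\}$, where $p_1,\dots,p_k$ is any basis of $U$ and $W(p_1,\dots,p_k)=\det\big(p_i^{(j-1)}\big)_{1\le i,j\le k}$ is the Wronskian determinant (equal to $1$ if $k=0$); a change of basis multiplies $W(p_1,\dots,p_k)$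 by a non-zero constant, so $W(U)$ does not depend on the basis. **Theorem.** Let $U\in\mathcal{G}_k\mathcal{P}_n$. Then $U^*\in\mathcal{G}_\ell\mathcal{P}_n$, $W(U)\in\mathcal{G}_1\mathcal{P}_{k\ell}$ (that is, the Wronskian of a basis of $U$ is non-zero and of degree at most $k\ell$), and $$W(U)=W(U^*).$$ That is, the Wronskian of a basis of $U$ and the Wronskian of a basis of $U^*$ agree up to a non-zero scalar. -/

import Mathlib

open Polynomial

/-- `𝒫 n`: the complex polynomials of degree at most `n`. -/
noncomputable abbrev PolyLE (n : ℕ) : Submodule ℂ ℂ[X] := Polynomial.degreeLE ℂ (n : WithBot ℕ)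

/-- The apolar form `γ` on `𝒫 n`, in coordinates:
`γ(p, q) = ∑_{j ≤ n} (-1)^j * j! * (n - j)! / n! * p_j * q_{n-j}`. It is the bilinear form with
`n! γ(z^j / j!, z^k / k!) = (-1)^j` if `j + k = n` and `0` otherwise
(see `apolarForm_monomial`). -/
noncomputable def apolarForm (n : ℕ) : LinearMap.BilinForm ℂ (PolyLE n) :=
  LinearMap.mk₂ ℂ
    (fun p q => ∑ j ∈ Finset.range (n + 1),
      (-1 : ℂ) ^ j * (j.factorial : ℂ) * ((n - j).factorial : ℂ) / (n.factorial : ℂ) *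
        (p : ℂ[X]).coeff j * (q : ℂ[X]).coeff (n - j))
    (fun p p' q => by
      rw [← Finset.sum_add_distrib]
      exact Finset.sum_congr rfl fun j _ => by simp; ring)
    (fun c p q => by
      rw [smul_eq_mul, Finset.mul_sum]
      exact Finset.sum_congr rfl fun j _ => by simp; ring)
    (fun p q q' => by
      rw [← Finset.sum_add_distrib]
      exact Finset.sum_congr rfl fun j _ => by simp; ring)
    (fun c p q => by
      rw [smul_eq_mul, Finset.mul_sum]
      exact Finset.sum_congr rfl fun j _ => by simp; ring)

theorem monomial_mem_polyLE {n j : ℕ} (hj : j ≤ n) (a : ℂ) : monomial j a ∈ PolyLE n :=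
  Polynomial.mem_degreeLE.2 ((degree_monomial_le j a).trans (by exact_mod_cast hj))

/-- The relations that define `γ`. -/
theorem apolarForm_monomial {n j k : ℕ} (hj : j ≤ n) (hk : k ≤ n) :
    (n.factorial : ℂ) *
      apolarForm n ⟨monomial j (1 / (j.factorial : ℂ)), monomial_mem_polyLE hj _⟩
        ⟨monomial k (1 / (k.factorial : ℂ)), monomial_mem_polyLE hk _⟩ =
      if j + k = n then (-1) ^ j else 0 := by
  have hn0 : (n.factorial : ℂ) ≠ 0 := by exact_mod_cast n.factorial_ne_zero
  have hj0 : (j.factorial : ℂ) ≠ 0 := by exact_mod_cast j.factorial_ne_zero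
  have hk0 : (k.factorial : ℂ) ≠ 0 := by exact_mod_cast k.factorial_ne_zero
  simp only [apolarForm, LinearMap.mk₂_apply, coeff_monomial]
  rw [Finset.sum_eq_single j]
  · by_cases h : j + k = n
    · have h' : n - j = k := by omega
      simp only [h', h, if_true]
      field_simp
    · have h' : ¬ k = n - j := by omega
      simp [h, h']
  · intro i _ hi
    simp [Ne.symm hi]
  · intro h
    exact absurd (Finset.mem_range.2 (by omega)) h

/-- The apolar dual `U* = {u ∈ 𝒫 n : γ(u, v) = 0 for all v ∈ U}`. -/
noncomputable def apolarDual {n : ℕ} (U : Submodule ℂ (PolyLE n)) : Submodule ℂ (PolyLE n) where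
  carrier := {u | ∀ v ∈ U, apolarForm n u v = 0}
  zero_mem' := fun v _ => by simp
  add_mem' := fun {a b} ha hb v hv => by simp [ha v hv, hb v hv]
  smul_mem' := fun c a ha v hv => by simp [ha v hv]

/-- The Wronskian `W(p₁, …, p_k)`: the determinant of the `k × k` matrix whose `i`-th row is
`pᵢ, pᵢ', …, pᵢ^(k-1)`. -/
noncomputable def wronskianDet {k : ℕ} (p : Fin k → ℂ[X]) : ℂ[X] :=
  (Matrix.of fun i j : Fin k => derivative^[(j : ℕ)] (p i)).det

/-- The Wronskian covariant `W(U)`: the subspace of `ℂ[z]` spanned by the Wronskian of a basis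
of `U`. The Wronskians of all bases are thrown in together; they are proportional, and any one
of them spans (see `wronskianCovariant_eq_span`). -/
noncomputable def wronskianCovariant {n : ℕ} (U : Submodule ℂ (PolyLE n)) : Submodule ℂ ℂ[X] :=
  Submodule.span ℂ
    {w | ∃ b : Module.Basis (Fin (Module.finrank ℂ U)) ℂ U,
      w = wronskianDet fun i => ((b i : PolyLE n) : ℂ[X])}

theorem wronskianDet_linearCombination {k : ℕ} (p q : Fin k → ℂ[X]) (A : Matrix (Fin k) (Fin k) ℂ)
    (h : ∀ i, q i = ∑ j, A i j • p j) : wronskianDet q = A.det • wronskianDet p := by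
  have hM : (Matrix.of fun i j : Fin k => derivative^[(j : ℕ)] (q i)) =
      A.map C * Matrix.of fun i j : Fin k => derivative^[(j : ℕ)] (p i) := by
    ext1 i j
    simp only [Matrix.of_apply, Matrix.mul_apply, Matrix.map_apply, h]
    rw [iterate_derivative_sum]
    exact Finset.sum_congr rfl fun x _ => by
      rw [iterate_derivative_smul, smul_eq_C_mul]
  rw [wronskianDet, hM, Matrix.det_mul, wronskianDet, smul_eq_C_mul]
  congr 1
  exact (RingHom.map_det C A).symm

/-- `W(U)` is spanned by the Wronskian of any basis of `U`. -/
theorem wronskianCovariant_eq_span {n k : ℕ} (U : Submodule ℂ (PolyLE n))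
    (b : Module.Basis (Fin k) ℂ U) :
    wronskianCovariant U =
      Submodule.span ℂ {wronskianDet fun i => ((b i : PolyLE n) : ℂ[X])} := by
  have hk : k = Module.finrank ℂ U := by simp [Module.finrank_eq_card_basis b]
  subst hk
  apply le_antisymm
  · refine Submodule.span_le.2 ?_
    rintro w ⟨b', rfl⟩
    refine Submodule.mem_span_singleton.2 ⟨(Matrix.of fun i j => b.repr (b' i) j).det, ?_⟩
    refine (wronskianDet_linearCombination _ _ _ fun i => ?_).symm
    have := congrArg ((PolyLE n).subtype ∘ₗ U.subtype) (b.sum_repr (b' i))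
    rw [map_sum] at this
    simp only [map_smul] at this
    exact this.symm
  · exact Submodule.span_mono (by rintro w rfl; exact ⟨b, rfl⟩)

/-! ### Degree and leading coefficient of a Wronskian -/

/-! The sum ∑ (-1)^j p^(j) q^(n-j) has telescoping derivative, hence is a constant, namely n! γ(p,
q) (`sum_iterate_derivative_mul_iterate_derivative`). So if a basis of `𝒫 n` extends one of U, its
Wronskian matrix times the signed, reversed Wronskian matrix of the γ-dual basis is n! times the
identity. Jacobi's identity equates, up to non-zero constants, a minor of the first matrix, W(U),
with the complementary minor of the second, W(U*) (`exists_wronskianDet_eq_smul`).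

Non-vanishing and the degree bound use a basis of U with strictly increasing degrees d_i: the
coefficient of W at degree ∑ d_i - ∑ i is the product of the leading coefficients and the
Vandermonde determinant of the d_i. -/

theorem natDegree_prod_le_sum {R ι : Type*} [CommSemiring R] (s : Finset ι) (f : ι → R[X])
    (d : ι → ℕ) (h : ∀ i, (f i).natDegree ≤ d i) :
    (∏ i ∈ s, f i).natDegree ≤ ∑ i ∈ s, d i :=
  (natDegree_prod_le s f).trans (Finset.sum_le_sum fun i _ => h i)

theorem coeff_prod_sum_of_natDegree_le {R ι : Type*} [CommSemiring R] (s : Finset ι)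
    (f : ι → R[X]) (d : ι → ℕ) (h : ∀ i, (f i).natDegree ≤ d i) :
    (∏ i ∈ s, f i).coeff (∑ i ∈ s, d i) = ∏ i ∈ s, (f i).coeff (d i) := by
  classical
  induction s using Finset.induction_on with
  | empty => simp
  | insert a s ha ih =>
    rw [Finset.prod_insert ha, Finset.sum_insert ha, Finset.prod_insert ha,
      coeff_mul_add_eq_of_natDegree_le (h a) (natDegree_prod_le_sum s f d h), ih]

theorem natDegree_det_le_sum {R ι : Type*} [CommRing R] [Fintype ι] [DecidableEq ι]
    (M : Matrix ι ι R[X]) (d : ι → ℕ) (h : ∀ i j, (M i j).natDegree ≤ d i) :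
    M.det.natDegree ≤ ∑ i, d i := by
  rw [Matrix.det_apply]
  refine natDegree_sum_le_of_forall_le _ _ fun σ _ => ?_
  refine (natDegree_smul_le _ _).trans ?_
  rw [← Equiv.sum_comp σ d]
  exact natDegree_prod_le_sum _ _ _ fun i => h _ _

theorem coeff_det_sum_of_natDegree_le {R ι : Type*} [CommRing R] [Fintype ι] [DecidableEq ι]
    (M : Matrix ι ι R[X]) (d : ι → ℕ) (h : ∀ i j, (M i j).natDegree ≤ d i) :
    M.det.coeff (∑ i, d i) = (Matrix.of fun i j => (M i j).coeff (d i)).det := by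
  rw [Matrix.det_apply, Matrix.det_apply, finsetSum_coeff]
  refine Finset.sum_congr rfl fun σ _ => ?_
  rw [← Equiv.sum_comp σ d, Units.smul_def, Units.smul_def, coeff_smul,
    coeff_prod_sum_of_natDegree_le _ _ _ fun i => h _ _]
  rfl

/-- The factor `X ^ j` on column `j` makes up for the degree lost to differentiation, so one bound
serves a whole row of the Wronskian matrix. -/
theorem natDegree_iterate_derivative_mul_X_pow_le (p : ℂ[X]) (j : ℕ) :
    (derivative^[j] p * X ^ j).natDegree ≤ p.natDegree := by
  by_cases hj : p.natDegree < j
  · simp [iterate_derivative_eq_zero hj]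
  · have h1 := natDegree_iterate_derivative p j
    have h2 : (derivative^[j] p * X ^ j).natDegree ≤ (derivative^[j] p).natDegree + j :=
      natDegree_mul_le_of_le le_rfl (natDegree_X_pow_le j)
    omega

theorem coeff_iterate_derivative_mul_X_pow (p : ℂ[X]) (j : ℕ) :
    (derivative^[j] p * X ^ j).coeff p.natDegree =
      p.leadingCoeff * (descPochhammer ℂ j).eval (p.natDegree : ℂ) := by
  rw [descPochhammer_eval_eq_descFactorial]
  by_cases hj : p.natDegree < j
  · simp [iterate_derivative_eq_zero hj, Nat.descFactorial_eq_zero_iff_lt.2 hj]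
  · rw [coeff_mul_X_pow', if_pos (not_lt.1 hj), coeff_iterate_derivative,
      Nat.sub_add_cancel (not_lt.1 hj), nsmul_eq_mul, mul_comm, leadingCoeff]

theorem det_iterate_derivative_mul_X_pow {k : ℕ} (p : Fin k → ℂ[X]) :
    (Matrix.of fun i j : Fin k => derivative^[(j : ℕ)] (p i) * X ^ (j : ℕ)).det =
      wronskianDet p * X ^ (∑ j : Fin k, (j : ℕ)) := by
  rw [wronskianDet, ← Finset.prod_pow_eq_pow_sum, mul_comm, ← Matrix.det_mul_row]
  simp only [Matrix.of_apply, mul_comm]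

theorem wronskianDet_ne_zero_of_strictMono {k : ℕ} (p : Fin k → ℂ[X]) (h0 : ∀ i, p i ≠ 0)
    (hp : StrictMono fun i => (p i).natDegree) : wronskianDet p ≠ 0 := by
  intro hW
  have h := coeff_det_sum_of_natDegree_le
    (Matrix.of fun i j : Fin k => derivative^[(j : ℕ)] (p i) * X ^ (j : ℕ))
    (fun i => (p i).natDegree) fun i j => by
      rw [Matrix.of_apply]
      exact natDegree_iterate_derivative_mul_X_pow_le _ _
  rw [det_iterate_derivative_mul_X_pow, hW] at h
  simp only [Matrix.of_apply, coeff_iterate_derivative_mul_X_pow, zero_mul, coeff_zero] at h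
  have hm := Matrix.det_mul_column (fun i => (p i).leadingCoeff)
    (Matrix.of fun i j : Fin k => (descPochhammer ℂ (j : ℕ)).eval ((p i).natDegree : ℂ))
  simp only [Matrix.of_apply] at hm
  -- Falling factorials are monic of degree `j`, so column operations turn them into powers.
  rw [hm, ← Matrix.det_eval_matrixOfPolynomials_eq_det_vandermonde
    (fun i => ((p i).natDegree : ℂ)) (fun j : Fin k => descPochhammer ℂ (j : ℕ))
    (fun j => descPochhammer_natDegree ℂ j) (fun j => monic_descPochhammer ℂ j)] at h
  refine mul_ne_zero ?_ ?_ h.symm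
  · exact Finset.prod_ne_zero_iff.2 fun i _ => leadingCoeff_ne_zero.2 (h0 i)
  · exact Matrix.det_vandermonde_ne_zero_iff.2 (Nat.cast_injective.comp hp.injective)

/-- The `k - 1 - i` later values must fit strictly between `d i` and `m`. -/
theorem StrictMono.add_sub_le_of_fin {k m : ℕ} {d : Fin k → ℕ} (hd : StrictMono d)
    (hm : ∀ i, d i < m) (i : Fin k) : d i + k ≤ m + i := by
  obtain ⟨i, hi⟩ := i
  induction h : k - i generalizing i with
  | zero => omega
  | succ r ih =>
    by_cases hk : i + 1 < k
    · have h1 := ih (i + 1) hk (by omega)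
      have h2 : d ⟨i, hi⟩ < d ⟨i + 1, hk⟩ := hd (by simp)
      simp only at h1 ⊢
      omega
    · have := hm ⟨i, hi⟩
      simp only
      omega

theorem natDegree_wronskianDet_le_of_strictMono {n k l : ℕ} (hkl : k + l = n + 1)
    (p : Fin k → ℂ[X]) (hn : ∀ i, (p i).natDegree ≤ n)
    (hp : StrictMono fun i => (p i).natDegree) : (wronskianDet p).natDegree ≤ k * l := by
  by_cases hW : wronskianDet p = 0
  · simp [hW]
  have h := natDegree_det_le_sum
    (Matrix.of fun i j : Fin k => derivative^[(j : ℕ)] (p i) * X ^ (j : ℕ))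
    (fun i => (p i).natDegree) fun i j => by
      rw [Matrix.of_apply]
      exact natDegree_iterate_derivative_mul_X_pow_le _ _
  rw [det_iterate_derivative_mul_X_pow, natDegree_mul_X_pow _ hW] at h
  -- With `m = n + 1 = k + l` the i-th degree is at most `l + i`; the sum of the `i` cancels the
  -- power of `X` in `h`.
  have h2 : ∑ i, (p i).natDegree ≤ ∑ i : Fin k, (l + (i : ℕ)) :=
    Finset.sum_le_sum fun i _ => by
      have := hp.add_sub_le_of_fin (m := n + 1) (fun i => Nat.lt_succ_of_le (hn i)) i
      omega
  rw [Finset.sum_add_distrib, Finset.sum_const, Finset.card_univ, Fintype.card_fin,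
    smul_eq_mul] at h2
  omega

/-! ### Bases with strictly increasing degrees -/

/-- A finite-dimensional space of polynomials has linearly independent elements of strictly
increasing degrees, as many as its dimension. -/
theorem exists_linearIndependent_strictMono_natDegree (N : ℕ) (V : Submodule ℂ ℂ[X])
    (hV : V ≤ degreeLT ℂ N) (k : ℕ) (hk : k ≤ Module.finrank ℂ V) :
    ∃ p : Fin k → ℂ[X], (∀ i, p i ∈ V) ∧ LinearIndependent ℂ p ∧
      StrictMono fun i => (p i).natDegree := by
  induction N generalizing V k with
  | zero =>
    have : V = ⊥ := by
      rw [eq_bot_iff]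
      intro x hx
      have := mem_degreeLT.1 (hV hx)
      simpa using this
    subst this
    obtain rfl : k = 0 := by simpa using hk
    exact ⟨Fin.elim0, fun i => i.elim0, linearIndependent_empty_type, fun i => i.elim0⟩
  | succ N ih =>
    by_cases hN : V ≤ degreeLT ℂ N
    · exact ih V hN k hk
    cases k with
    | zero => exact ⟨Fin.elim0, fun i => i.elim0, linearIndependent_empty_type, fun i => i.elim0⟩
    | succ k =>
      obtain ⟨v, hvV, hvN⟩ := Set.not_subset.1 hN
      have hcoef : ∀ w ∈ V, w.coeff N = 0 → w ∈ degreeLT ℂ N := by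
        intro w hw h0
        rw [mem_degreeLT, degree_lt_iff_coeff_zero]
        intro m hm
        rcases hm.eq_or_lt with rfl | hm
        · exact h0
        · exact (degree_lt_iff_coeff_zero _ _).1 (mem_degreeLT.1 (hV hw)) m hm
      have hv0 : v.coeff N ≠ 0 := fun h => hvN (hcoef v hvV h)
      -- Subtracting a multiple of `v` kills the coefficient of `X ^ N`, so passing to degree below
      -- `N` loses at most one dimension.
      have hle : V ≤ (V ⊓ degreeLT ℂ N) ⊔ ℂ ∙ v := by
        intro w hw
        have hm : w - (w.coeff N / v.coeff N) • v ∈ V :=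
          V.sub_mem hw (V.smul_mem _ hvV)
        rw [← sub_add_cancel w ((w.coeff N / v.coeff N) • v)]
        refine Submodule.add_mem_sup ⟨hm, hcoef _ hm ?_⟩
          (Submodule.smul_mem _ _ (Submodule.mem_span_singleton_self v))
        simp [hv0]
      have hfd : FiniteDimensional ℂ (degreeLT ℂ N) :=
        Module.Finite.equiv (degreeLTEquiv ℂ N).symm
      have hfd' : FiniteDimensional ℂ (V ⊓ degreeLT ℂ N : Submodule ℂ ℂ[X]) :=
        Submodule.finiteDimensional_of_le inf_le_right
      have h1 := Submodule.finrank_mono hle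
      have h2 := Submodule.finrank_add_le_finrank_add_finrank (V ⊓ degreeLT ℂ N) (ℂ ∙ v)
      rw [finrank_span_singleton (by rintro rfl; simp at hv0)] at h2
      obtain ⟨p, hpV, hpl, hpm⟩ := ih (V ⊓ degreeLT ℂ N) inf_le_right k (by omega)
      have hvd : N ≤ v.natDegree := le_natDegree_of_ne_zero hv0
      refine ⟨Fin.snoc p v, ?_, ?_, ?_⟩
      · intro i
        induction i using Fin.lastCases with
        | last => simpa using hvV
        | cast i => simpa using (hpV i).1
      · refine linearIndependent_finSnoc.2 ⟨hpl, fun h => hvN ?_⟩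
        exact Submodule.span_le.2 (Set.range_subset_iff.2 fun i => (hpV i).2) h
      · intro i j
        induction i using Fin.lastCases with
        | last => exact fun h => absurd h (Fin.le_last j).not_gt
        | cast i =>
          induction j using Fin.lastCases with
          | last =>
            intro _
            simp only [Fin.snoc_castSucc, Fin.snoc_last]
            exact ((natDegree_lt_iff_degree_lt (hpl.ne_zero i)).2
              (mem_degreeLT.1 (hpV i).2)).trans_le hvd
          | cast j => exact fun h => by simpa using hpm (Fin.castSucc_lt_castSucc_iff.1 h)

theorem PolyLE.natDegree_le {n : ℕ} (p : PolyLE n) : (p : ℂ[X]).natDegree ≤ n :=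
  natDegree_le_iff_degree_le.2 (mem_degreeLE.1 p.2)

instance (n : ℕ) : FiniteDimensional ℂ (PolyLE n) := by
  rw [PolyLE, ← degreeLT_succ_eq_degreeLE]
  exact Module.Finite.equiv (degreeLTEquiv ℂ (n + 1)).symm

theorem finrank_polyLE (n : ℕ) : Module.finrank ℂ (PolyLE n) = n + 1 := by
  rw [PolyLE, ← degreeLT_succ_eq_degreeLE, (degreeLTEquiv ℂ (n + 1)).finrank_eq]
  simp

theorem LinearIndependent.exists_basis_submodule {K V ι : Type*} [Field K]
    [AddCommGroup V] [Module K V] [FiniteDimensional K V] [Fintype ι] {v : ι → V}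
    (hv : LinearIndependent K v) (U : Submodule K V) (hU : ∀ i, v i ∈ U)
    (h : Fintype.card ι = Module.finrank K U) :
    ∃ b : Module.Basis ι K U, ∀ i, (b i : V) = v i := by
  have hv' : LinearIndependent K fun i => (⟨v i, hU i⟩ : U) :=
    LinearIndependent.of_comp U.subtype hv
  exact ⟨Module.Basis.mk hv' (hv'.span_eq_top_of_card_eq_finrank' h).ge, fun i => by
    rw [Module.Basis.mk_apply]⟩

theorem exists_basis_strictMono_natDegree {n k : ℕ} (U : Submodule ℂ (PolyLE n))
    (hU : Module.finrank ℂ U = k) :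
    ∃ b : Module.Basis (Fin k) ℂ U, StrictMono fun i => ((b i : PolyLE n) : ℂ[X]).natDegree := by
  have hV : U.map (PolyLE n).subtype ≤ degreeLT ℂ (n + 1) := by
    rw [degreeLT_succ_eq_degreeLE]
    exact Submodule.map_subtype_le _ _
  have hr : Module.finrank ℂ (U.map (PolyLE n).subtype) = k := by
    rw [Submodule.finrank_map_subtype_eq, hU]
  obtain ⟨p, hpV, hpl, hpm⟩ :=
    exists_linearIndependent_strictMono_natDegree (n + 1) _ hV k hr.ge
  choose q hqU hqp using fun i => Submodule.mem_map.1 (hpV i)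
  obtain rfl : p = fun i => (q i : ℂ[X]) := (funext hqp).symm
  have hli : LinearIndependent ℂ q := LinearIndependent.of_comp (PolyLE n).subtype hpl
  obtain ⟨b, hb⟩ := hli.exists_basis_submodule U hqU (by rw [Fintype.card_fin, hU])
  refine ⟨b, ?_⟩
  simpa only [hb] using hpm

/-! ### The apolar form as a constant polynomial, and duality -/

/-- The derivative telescopes to terms containing an (n+1)-st derivative of `p` or `q`, which
vanish; the constant is then read off at 0. -/
theorem sum_iterate_derivative_mul_iterate_derivative {n : ℕ} (p q : PolyLE n) :
    ∑ j ∈ Finset.range (n + 1),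
        (-1 : ℂ[X]) ^ j * (derivative^[j] (p : ℂ[X]) * derivative^[n - j] (q : ℂ[X])) =
      C ((n.factorial : ℂ) * apolarForm n p q) := by
  set S := ∑ j ∈ Finset.range (n + 1),
    (-1 : ℂ[X]) ^ j * (derivative^[j] (p : ℂ[X]) * derivative^[n - j] (q : ℂ[X])) with hS
  have hd : derivative S = 0 := by
    rw [hS, derivative_sum]
    have : ∀ j ∈ Finset.range (n + 1), derivative ((-1 : ℂ[X]) ^ j *
        (derivative^[j] (p : ℂ[X]) * derivative^[n - j] (q : ℂ[X]))) =
        (fun m => -((-1 : ℂ[X]) ^ m *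
          (derivative^[m] (p : ℂ[X]) * derivative^[n + 1 - m] (q : ℂ[X])))) (j + 1) -
        (fun m => -((-1 : ℂ[X]) ^ m *
          (derivative^[m] (p : ℂ[X]) * derivative^[n + 1 - m] (q : ℂ[X])))) j := by
      intro j hj
      have h1 : n + 1 - j = n - j + 1 := by have := Finset.mem_range.1 hj; omega
      have h2 : derivative ((-1 : ℂ[X]) ^ j) = 0 := by
        rw [show (-1 : ℂ[X]) ^ j = C ((-1) ^ j) by simp, derivative_C]
      simp only [derivative_mul, h2, h1, Nat.add_sub_add_right, Function.iterate_succ_apply']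
      ring
    rw [Finset.sum_congr rfl this, Finset.sum_range_sub (fun m => -((-1 : ℂ[X]) ^ m *
      (derivative^[m] (p : ℂ[X]) * derivative^[n + 1 - m] (q : ℂ[X]))))]
    rw [iterate_derivative_eq_zero (Nat.lt_succ_of_le (PolyLE.natDegree_le p))]
    simp [iterate_derivative_eq_zero (Nat.lt_succ_of_le (PolyLE.natDegree_le q)),
      -Function.iterate_succ]
  rw [eq_C_of_natDegree_eq_zero (derivative_eq_zero.1 hd)]
  congr 1
  have hn0 : (n.factorial : ℂ) ≠ 0 := by exact_mod_cast n.factorial_ne_zero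
  simp only [hS, apolarForm, LinearMap.mk₂_apply]
  rw [finsetSum_coeff, Finset.mul_sum]
  refine Finset.sum_congr rfl fun j _ => ?_
  rw [show (-1 : ℂ[X]) ^ j = C ((-1) ^ j) by simp, coeff_C_mul, mul_coeff_zero,
    coeff_iterate_derivative, coeff_iterate_derivative]
  simp only [zero_add, Nat.descFactorial_self, nsmul_eq_mul]
  field_simp

theorem apolarForm_monomial_right {n j : ℕ} (hj : j ≤ n) (p : PolyLE n) :
    apolarForm n p ⟨monomial (n - j) 1, monomial_mem_polyLE (Nat.sub_le n j) _⟩ =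
      (-1 : ℂ) ^ j * (j.factorial : ℂ) * ((n - j).factorial : ℂ) / (n.factorial : ℂ) *
        (p : ℂ[X]).coeff j := by
  simp only [apolarForm, LinearMap.mk₂_apply, coeff_monomial]
  rw [Finset.sum_eq_single j]
  · simp
  · intro i hi hij
    have := Finset.mem_range.1 hi
    rw [if_neg (by omega), mul_zero]
  · intro h
    exact absurd (Finset.mem_range.2 (by omega)) h

theorem apolarForm_nondegenerate (n : ℕ) : (apolarForm n).Nondegenerate := by
  rw [LinearMap.BilinForm.nondegenerate_iff_ker_eq_bot, LinearMap.ker_eq_bot']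
  intro p hp
  ext j
  rw [ZeroMemClass.coe_zero, coeff_zero]
  by_cases hj : j ≤ n
  · have h := apolarForm_monomial_right hj p
    rw [hp, LinearMap.zero_apply] at h
    have h0 : (-1 : ℂ) ^ j * (j.factorial : ℂ) * ((n - j).factorial : ℂ) /
        (n.factorial : ℂ) ≠ 0 := by
      simp [Nat.factorial_ne_zero]
    exact (mul_eq_zero.1 h.symm).resolve_left h0
  · exact coeff_eq_zero_of_natDegree_lt ((PolyLE.natDegree_le p).trans_lt (not_le.1 hj))

/-! ### Dual bases and complementary minors -/

/-- A basis of the ambient space adapted to a subspace. -/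
theorem Submodule.exists_basis_sum_extending {K V ι : Type*} [Field K] [AddCommGroup V]
    [Module K V] [FiniteDimensional K V] [Fintype ι] (U : Submodule K V)
    (b : Module.Basis ι K U) {l : ℕ} (hl : Fintype.card ι + l = Module.finrank K V) :
    ∃ B : Module.Basis (ι ⊕ Fin l) K V, ∀ i, B (Sum.inl i) = b i := by
  obtain ⟨U', hU'⟩ := U.exists_isCompl
  have h1 := Submodule.finrank_add_eq_of_isCompl hU'
  rw [Module.finrank_eq_card_basis b] at h1
  let b' : Module.Basis (Fin l) K U' := Module.finBasisOfFinrankEq K U' (by omega)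
  exact ⟨(b.prod b').map (Submodule.prodEquivOfIsCompl U U' hU'), fun i => by simp⟩

/-- If the first vectors of a basis of `𝒫 n` span `U`, the remaining vectors of the `γ`-dual
basis form a basis of `U*`. -/
theorem exists_basis_apolarDual {n k l : ℕ} (U : Submodule ℂ (PolyLE n))
    (b : Module.Basis (Fin k) ℂ U) (B : Module.Basis (Fin k ⊕ Fin l) ℂ (PolyLE n))
    (hB : ∀ i, B (Sum.inl i) = b i) :
    ∃ c : Module.Basis (Fin l) ℂ (apolarDual U), ∀ j, (c j : PolyLE n) =
      (apolarForm n).dualBasis (apolarForm_nondegenerate n) B (Sum.inr j) := by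
  set D := (apolarForm n).dualBasis (apolarForm_nondegenerate n) B with hD
  have hmem : ∀ j, D (Sum.inr j) ∈ apolarDual U := by
    intro j v hv
    have hv' : v ∈ Submodule.span ℂ (Set.range fun i => (b i : PolyLE n)) := by
      have h := b.mem_span ⟨v, hv⟩
      have h' := Submodule.mem_map_of_mem (f := U.subtype) h
      rwa [Submodule.map_span, ← Set.range_comp] at h'
    refine Submodule.span_induction (p := fun v _ => apolarForm n (D (Sum.inr j)) v = 0)
      ?_ (by simp) (fun x y _ _ hx hy => by simp [hx, hy]) (fun a x _ hx => by simp [hx]) hv'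
    rintro _ ⟨i, rfl⟩
    simp only
    rw [← hB, hD, LinearMap.BilinForm.apply_dualBasis_left, if_neg (by simp)]
  have hli : LinearIndependent ℂ fun j => (⟨D (Sum.inr j), hmem j⟩ : apolarDual U) := by
    refine LinearIndependent.of_comp (apolarDual U).subtype ?_
    exact D.linearIndependent.comp Sum.inr Sum.inr_injective
  refine ⟨Module.Basis.mk hli ?_, fun j => by rw [Module.Basis.mk_apply]⟩
  rintro ⟨u, hu⟩ -
  have h : (⟨u, hu⟩ : apolarDual U) =
      ∑ j, D.repr u (Sum.inr j) • (⟨D (Sum.inr j), hmem j⟩ : apolarDual U) := by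
    apply Subtype.ext
    -- Coordinates in the dual basis are the pairings `γ(u, B i)`.
    have h0 : ∀ i, D.repr u (Sum.inl i) = 0 := fun i => by
      rw [hD, LinearMap.BilinForm.dualBasis_repr_apply, hB]
      exact hu _ (b i).2
    have hu' := D.sum_repr u
    rw [Fintype.sum_sum_type] at hu'
    simp only [h0, zero_smul, Finset.sum_const_zero, zero_add] at hu'
    simpa using hu'.symm
  rw [h]
  exact Submodule.sum_mem _ fun j _ => Submodule.smul_mem _ _ (Submodule.subset_span ⟨j, rfl⟩)

/-- A form of Jacobi's identity between complementary minors. -/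
theorem Matrix.det_mul_det_toBlocks₂₂_of_mul_eq_smul_one {R m n : Type*} [CommRing R]
    [Fintype m] [Fintype n] [DecidableEq m] [DecidableEq n] (D F : Matrix (m ⊕ n) (m ⊕ n) R)
    (a : R) (h : D * F = a • 1) :
    D.det * F.toBlocks₂₂.det = a ^ Fintype.card n * D.toBlocks₁₁.det := by
  -- Replacing the first block column of `F` by that of the identity makes both sides block
  -- triangular up to the factor `D`; determinants then give the claim.
  have h' : D * fromBlocks 1 F.toBlocks₁₂ 0 F.toBlocks₂₂ =
      fromBlocks D.toBlocks₁₁ 0 D.toBlocks₂₁ (a • 1) := by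
    rw [← fromBlocks_toBlocks D, ← fromBlocks_toBlocks F, fromBlocks_multiply,
      ← fromBlocks_one, fromBlocks_smul, fromBlocks_inj] at h
    conv_lhs => rw [← fromBlocks_toBlocks D]
    rw [fromBlocks_multiply, h.2.1, h.2.2.2]
    simp
  have := congrArg det h'
  rw [det_mul, det_fromBlocks_zero₂₁, det_fromBlocks_zero₁₂, det_smul] at this
  simpa [mul_comm] using this

/-- Complementary families of `γ`-dual bases have proportional Wronskians. -/
theorem exists_wronskianDet_eq_smul {n k l : ℕ} (hkl : k + l = n + 1)
    (p q : Fin k ⊕ Fin l → PolyLE n)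
    (h : ∀ i j, apolarForm n (q i) (p j) = if j = i then 1 else 0) :
    ∃ c : ℂ, c ≠ 0 ∧ (wronskianDet fun j => ((q (Sum.inr j) : PolyLE n) : ℂ[X])) =
      c • wronskianDet fun i => ((p (Sum.inl i) : PolyLE n) : ℂ[X]) := by
  let e : Fin k ⊕ Fin l ≃ Fin (n + 1) := finSumFinEquiv.trans (finCongr hkl)
  let D : Matrix (Fin k ⊕ Fin l) (Fin k ⊕ Fin l) ℂ[X] :=
    Matrix.of fun i j => derivative^[(e j : ℕ)] (p i : ℂ[X])
  let F : Matrix (Fin k ⊕ Fin l) (Fin k ⊕ Fin l) ℂ[X] :=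
    Matrix.of fun j b => (-1) ^ (n - (e j : ℕ)) * derivative^[n - (e j : ℕ)] (q b : ℂ[X])
  have hn0 : (n.factorial : ℂ) ≠ 0 := by exact_mod_cast n.factorial_ne_zero
  have hDF : D * F = (C (n.factorial : ℂ)) • 1 := by
    ext1 i b
    have h1 : (D * F) i b = ∑ j : Fin (n + 1), derivative^[(j : ℕ)] (p i : ℂ[X]) *
        ((-1) ^ (n - (j : ℕ)) * derivative^[n - (j : ℕ)] (q b : ℂ[X])) :=
      Equiv.sum_comp e fun j : Fin (n + 1) => derivative^[(j : ℕ)] (p i : ℂ[X]) *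
        ((-1) ^ (n - (j : ℕ)) * derivative^[n - (j : ℕ)] (q b : ℂ[X]))
    rw [h1, Fin.sum_univ_eq_sum_range fun j => derivative^[j] (p i : ℂ[X]) *
        ((-1) ^ (n - j) * derivative^[n - j] (q b : ℂ[X])), ← Finset.sum_range_reflect]
    have h2 := sum_iterate_derivative_mul_iterate_derivative (q b) (p i)
    rw [h] at h2
    rw [Matrix.smul_apply, Matrix.one_apply]
    trans C ((n.factorial : ℂ) * if i = b then 1 else 0)
    · rw [← h2]
      refine Finset.sum_congr rfl fun j hj => ?_
      have hj' := Finset.mem_range.1 hj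
      rw [show n + 1 - 1 - j = n - j by omega, show n - (n - j) = j by omega]
      ring
    · split_ifs <;> simp
  have hdet := Matrix.det_mul_det_toBlocks₂₂_of_mul_eq_smul_one D F _ hDF
  -- The full Wronskian divides a power of `n!`, so it is a non-zero constant.
  have hunit : IsUnit D.det := by
    have hd := congrArg Matrix.det hDF
    rw [Matrix.det_mul, Matrix.det_smul, Matrix.det_one, mul_one] at hd
    exact isUnit_of_mul_isUnit_left
      (hd ▸ ((isUnit_C.2 (isUnit_iff_ne_zero.2 hn0)).pow _))
  obtain ⟨d, hd, hdD⟩ := isUnit_iff.1 hunit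
  have hD11 : D.toBlocks₁₁.det = wronskianDet fun i => ((p (Sum.inl i) : PolyLE n) : ℂ[X]) := by
    rfl
  have hF22 : F.toBlocks₂₂.det = C ((∏ j : Fin l, (-1 : ℂ) ^ (j : ℕ)) *
      ((Equiv.Perm.sign (Fin.revPerm : Equiv.Perm (Fin l)) : ℤ) : ℂ)) *
      wronskianDet fun j => ((q (Sum.inr j) : PolyLE n) : ℂ[X]) := by
    -- Row `k + i` of `F` carries derivatives of order `n - (k + i) = l - 1 - i`: these are the
    -- orders of an `l × l` Wronskian, reversed.
    have hF : F.toBlocks₂₂ = ((Matrix.of fun i j : Fin l => (-1 : ℂ[X]) ^ (j : ℕ) *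
        (Matrix.of fun i j : Fin l =>
          derivative^[(j : ℕ)] ((q (Sum.inr i) : PolyLE n) : ℂ[X])) i j).transpose).submatrix
        Fin.revPerm id := by
      ext1 i j
      have hi : n - (k + (i : ℕ)) = l - (i + 1) := by omega
      simp [F, e, Matrix.toBlocks₂₂, hi, Fin.val_rev]
    rw [hF, Matrix.det_permute, Matrix.det_transpose, Matrix.det_mul_row, wronskianDet]
    simp only [map_mul, map_prod, map_pow, map_neg, map_one, map_intCast]
    ring
  rw [hD11, hF22, ← hdD, Fintype.card_fin, ← C_pow] at hdet
  set s : ℂ := (∏ j : Fin l, (-1 : ℂ) ^ (j : ℕ)) *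
      ((Equiv.Perm.sign (Fin.revPerm : Equiv.Perm (Fin l)) : ℤ) : ℂ) with hs
  have hs0 : s ≠ 0 := by
    refine mul_ne_zero (Finset.prod_ne_zero_iff.2 fun j _ => by simp) ?_
    exact_mod_cast (Equiv.Perm.sign (Fin.revPerm : Equiv.Perm (Fin l))).ne_zero
  have hd0 : d ≠ 0 := hd.ne_zero
  refine ⟨(d * s)⁻¹ * (n.factorial : ℂ) ^ l, by positivity, ?_⟩
  rw [mul_smul, eq_inv_smul_iff₀ (mul_ne_zero hd0 hs0), smul_eq_C_mul, smul_eq_C_mul, C_mul,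
    mul_assoc]
  exact hdet

theorem theorem4p6 (n k l : ℕ) (hkl : k + l = n + 1)
    (U : Submodule ℂ (PolyLE n)) (hU : Module.finrank ℂ U = k) :
    Module.finrank ℂ (apolarDual U) = l ∧
      wronskianCovariant U ≤ PolyLE (k * l) ∧
      Module.finrank ℂ (wronskianCovariant U) = 1 ∧
      wronskianCovariant U = wronskianCovariant (apolarDual U) := by
  obtain ⟨b, hb⟩ := exists_basis_strictMono_natDegree U hU
  obtain ⟨B, hB⟩ := U.exists_basis_sum_extending b (l := l) (by
    rw [Fintype.card_fin, finrank_polyLE, hkl])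
  obtain ⟨c, hc⟩ := exists_basis_apolarDual U b B hB
  obtain ⟨a, ha, hW⟩ := exists_wronskianDet_eq_smul hkl B
    ((apolarForm n).dualBasis (apolarForm_nondegenerate n) B)
    fun i j => LinearMap.BilinForm.apply_dualBasis_left _ _ _ _
  have hb0 : ∀ i, ((b i : PolyLE n) : ℂ[X]) ≠ 0 := fun i => by
    simpa using b.ne_zero i
  rw [wronskianCovariant_eq_span U b, wronskianCovariant_eq_span (apolarDual U) c]
  refine ⟨by simp [Module.finrank_eq_card_basis c], ?_, ?_, ?_⟩
  · rw [Submodule.span_singleton_le_iff_mem, mem_degreeLE]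
    exact natDegree_le_iff_degree_le.1
      (natDegree_wronskianDet_le_of_strictMono hkl _ (fun i => PolyLE.natDegree_le _) hb)
  · exact finrank_span_singleton (wronskianDet_ne_zero_of_strictMono _ hb0 hb)
  · simp only [hc, hW, hB]
    exact (Submodule.span_singleton_smul_eq (isUnit_iff_ne_zero.2 ha) _).symm
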